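/- Let $n\ge 2$ and $0<c<1$. For $\nu\in\mathbb N_+=\{1,2,3,\dots\}$ let $\mathcal T(\nu)$ be Student's t distribution with $\nu$ degrees of freedom, i.e. the distribution on $\mathbb R$ with density $$f_\nu(t)=\frac{1}{\sqrt{\nu\pi}}\,\frac{\Gamma\left(\frac{\nu+1}{2}\right)}{\Gamma\left(\frac{\nu}{2}\right)}\left(1+\frac{t^2}{\nu}\right)^{-\frac{\nu+1}{2}},$$ and let $\mathcal T(\infty)=\mathcal N(0,1)$. For an i.i.d. sample $X_1,\dots,X_n$ from $\mathcal T(\nu)$, $\nu\in\mathbb N_+\cup\{\infty\}$, let $$S_n=\frac{\sum_{i=1}^n|X_i|^2}{\left(\sum_{i=1}^n|X_i|\right)^2}.$$ Consider the test $MG_2$ of $\mathcal H_0:\nu=\infty$ (the sample is Gaussian) against $\mathcal H_1:\nu<\infty$ which rejects $\mathcal H_0$ when $S_n\in[Q_{1-c}(n),1]$, where $Q_{1-c}(n)$ is the quantile of order $1-c$ of the distribution of $S_n$ under $\mathcal H_0$. Let $\beta(\nu)=\mathbb P_\nu\left(S_n\in[Q_{1-c}(n),1]\right)$, $\nu\in\mathbb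 N_+\cup\{\infty\}$, be its power function. Then the test has size $c$, i.e. $\beta(\infty)=c$; it is unbiased, i.e. $\beta(\nu)\ge\beta(\infty)$ for all $\nu\in\mathbb N_+$; and its power function is non-increasing in the degrees of freedom: $\beta(\nu_1)\ge\beta(\nu_2)$ whenever $\nu_1\le\nu_2$ in $\mathbb N_+\cup\{\infty\}$. -/

import Mathlib

open MeasureTheory ProbabilityTheory

noncomputable section

/-- The modified Greenwood statistic `S_n = (∑ |x_i|²) / (∑ |x_i|)²` of a real sample. -/
def modifiedGreenwood (n : ℕ) (x : Fin n → ℝ) : ℝ :=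
  (∑ i, |x i| ^ 2) / (∑ i, |x i|) ^ 2

/-- The probability density of Student's t distribution with `ν` degrees of freedom. -/
def studentTDensity (ν : ℕ+) (t : ℝ) : ℝ :=
  1 / √((ν : ℝ) * Real.pi) * (Real.Gamma (((ν : ℝ) + 1) / 2) / Real.Gamma ((ν : ℝ) / 2)) *
    (1 + t ^ 2 / (ν : ℝ)) ^ (-(((ν : ℝ) + 1) / 2))

/-- Student's t distribution `T(ν)`, where `ν` is a positive integer or `∞`, and `T(∞)` is the
standard normal distribution. -/
def studentT : WithTop ℕ+ → Measure ℝ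
  | ⊤ => gaussianReal 0 1
  | (m : ℕ+) => volume.withDensity fun t => ENNReal.ofReal (studentTDensity m t)

/-- The joint law of an i.i.d. sample `X_1, …, X_n` from `T(ν)`. -/
def studentTSample (n : ℕ) (ν : WithTop ℕ+) : Measure (Fin n → ℝ) :=
  Measure.pi fun _ => studentT ν

/-- The quantile of order `p` of a probability distribution on `ℝ`:
the least `q` with `p ≤ F(q)`, for `0 < p < 1`. -/
def quantile (μ : Measure ℝ) (p : ℝ) : ℝ :=
  sInf {q : ℝ | p ≤ cdf μ q}

/-- The critical value of level `c`: the quantile of order `1 - c` of the law of `S_n` when the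
sample is Gaussian. -/
def mgCriticalValue (n : ℕ) (c : ℝ) : ℝ :=
  quantile ((studentTSample n ⊤).map (modifiedGreenwood n)) (1 - c)

/-- The rejection region: the samples for which `S_n` lies in `[Q, 1]`, where `Q` is the critical
value of level `c`. -/
def mgRejectionRegion (n : ℕ) (c : ℝ) : Set (Fin n → ℝ) :=
  {x | modifiedGreenwood n x ∈ Set.Icc (mgCriticalValue n c) 1}

/-- The power function of the test with rejection region `R` in the model `(P θ)`: the probability
of rejection when the parameter is `θ`. -/
def powerFunction {Θ 𝓧 : Type*} [MeasurableSpace 𝓧] (P : Θ → Measure 𝓧) (R : Set 𝓧) (θ : Θ) : ℝ :=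
  (P θ).real R

/-- The test with rejection region `R` of the null hypothesis `θ ∈ H₀` has size `c`: the supremum
of its power function over `H₀` is `c`. -/
def HasSize {Θ 𝓧 : Type*} [MeasurableSpace 𝓧] (P : Θ → Measure 𝓧) (R : Set 𝓧) (H₀ : Set Θ)
    (c : ℝ) : Prop :=
  IsLUB (powerFunction P R '' H₀) c

/-- The test with rejection region `R` of `θ ∈ H₀` against `θ ∈ H₁` is unbiased: under every
alternative it rejects at least as often as under every null parameter. -/
def IsUnbiasedTest {Θ 𝓧 : Type*} [MeasurableSpace 𝓧] (P : Θ → Measure 𝓧) (R : Set 𝓧)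
    (H₀ H₁ : Set Θ) : Prop :=
  ∀ θ₀ ∈ H₀, ∀ θ₁ ∈ H₁, powerFunction P R θ₀ ≤ powerFunction P R θ₁

end

/-!
The statistic `S_n` depends only on the moduli of the sample, and it grows under star-shaped maps:
if `ψ` is odd and `ψ x / x` is nondecreasing in `x > 0`, then replacing each `X_i` by `ψ (X_i)` does
not decrease `S_n` (`greenwood_le_of_comonotone`, by Chebyshev's sum inequality and Cauchy-Schwarz).
Hence the power function is antitone as soon as, for `ν₁ ≤ ν₂`, some star-shaped map carries
`T(ν₂)` to `T(ν₁)`.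

The map is the quantile transform `ψ = G⁻¹ ∘ F`, where `F` and `G` are the distribution functions
of `T(ν₂)` and `T(ν₁)`. It is star-shaped if, for every `c > 0`, the difference `F(s) - G(c s)`
stays nonnegative on `s > 0` once it has been positive. This difference vanishes at `0` and at
infinity, so it suffices that its derivative `f(s) - c g(c s)` is nonnegative exactly on an interval
(`scaled_cdf_crossing`, `HasEvenPosDensity.exists_starShaped_map`). For Student densities, a power
of the inequality `c g(c s) ≤ f(s)` reads `affine ≤ concave` in the variable `s²`, and for a Gaussian
`f` its logarithm does, so the solution set is indeed an interval
(`ordConnected_studentTDensity_le`, `ordConnected_studentTDensity_le_gaussianPDFReal`).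

The size is exactly `c` because the law of `S_n` has no atoms under the null hypothesis when `n ≥ 2`
(`pi_modifiedGreenwood_eq_null`), so that its distribution function takes the value `1 - c` at the
quantile of that order (`cdf_quantile`).
-/

open Filter Topology

/-! ### The modified Greenwood statistic -/

/-- The ratio `(∑ uᵢ²) / (∑ uᵢ)²` increases when `u` is replaced by a vector `v` such that `vᵢ / uᵢ`
is a nondecreasing function of `uᵢ`. Writing `p`, `q` for the normalised vectors, Chebyshev's sum
inequality gives `∑ pᵢ² ≤ ∑ pᵢ qᵢ`, and Cauchy-Schwarz turns this into `∑ pᵢ² ≤ ∑ qᵢ²`. -/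
lemma greenwood_le_of_comonotone {ι : Type*} [Fintype ι] {u v : ι → ℝ}
    (hu : ∀ i, 0 ≤ u i) (hv : ∀ i, 0 ≤ v i) (h0 : ∀ i, v i = 0 → u i = 0)
    (huv : ∀ i j, u i ≤ u j → v i * u j ≤ v j * u i) :
    (∑ i, u i ^ 2) / (∑ i, u i) ^ 2 ≤ (∑ i, v i ^ 2) / (∑ i, v i) ^ 2 := by
  have hU : 0 ≤ ∑ i, u i := Finset.sum_nonneg fun i _ => hu i
  have hV : 0 ≤ ∑ i, v i := Finset.sum_nonneg fun i _ => hv i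
  have hU2 : 0 ≤ ∑ i, u i ^ 2 := Finset.sum_nonneg fun i _ => sq_nonneg _
  have hV2 : 0 ≤ ∑ i, v i ^ 2 := Finset.sum_nonneg fun i _ => sq_nonneg _
  rcases hU.eq_or_lt with hU0 | hUpos
  · rw [← hU0]; simp; positivity
  have hVpos : 0 < ∑ i, v i := by
    refine hV.lt_of_ne fun h => hUpos.ne' ?_
    have := (Finset.sum_eq_zero_iff_of_nonneg fun i _ => hv i).1 h.symm
    exact Finset.sum_eq_zero fun i hi => h0 i (this i hi)
  -- Chebyshev's sum inequality for the weights `u`, in the form of a nonnegative double sum.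
  have hcheb : (∑ i, v i) * (∑ i, u i ^ 2) ≤ (∑ i, u i * v i) * ∑ i, u i := by
    have h : 0 ≤ ∑ i, ∑ j, (v i * u j - v j * u i) * (u i - u j) := by
      refine Finset.sum_nonneg fun i _ => Finset.sum_nonneg fun j _ => ?_
      rcases le_total (u i) (u j) with hij | hij
      · exact mul_nonneg_of_nonpos_of_nonpos (sub_nonpos.2 (huv i j hij)) (sub_nonpos.2 hij)
      · exact mul_nonneg (sub_nonneg.2 (huv j i hij)) (sub_nonneg.2 hij)
    have e : ∑ i, ∑ j, (v i * u j - v j * u i) * (u i - u j)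
        = ((∑ i, u i * v i) * (∑ j, u j) - (∑ i, v i) * ∑ j, u j ^ 2)
          - ((∑ i, u i ^ 2) * (∑ j, v j) - (∑ i, u i) * ∑ j, u j * v j) := by
      simp only [Finset.sum_mul_sum, ← Finset.sum_sub_distrib]
      exact Finset.sum_congr rfl fun i _ => Finset.sum_congr rfl fun j _ => by ring
    rw [e] at h
    nlinarith
  have hcs := Finset.sum_mul_sq_le_sq_mul_sq Finset.univ u v
  have hU2pos : 0 < ∑ i, u i ^ 2 := by
    refine hU2.lt_of_ne fun h => hUpos.ne' ?_
    have := (Finset.sum_eq_zero_iff_of_nonneg fun i _ => sq_nonneg (u i)).1 h.symm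
    exact Finset.sum_eq_zero fun i hi => by simpa using this i hi
  rw [div_le_div_iff₀ (by positivity) (by positivity)]
  refine le_of_mul_le_mul_left ?_ hU2pos
  calc (∑ i, u i ^ 2) * ((∑ i, u i ^ 2) * (∑ i, v i) ^ 2)
      = ((∑ i, v i) * (∑ i, u i ^ 2)) ^ 2 := by ring
    _ ≤ ((∑ i, u i * v i) * ∑ i, u i) ^ 2 := pow_le_pow_left₀ (by positivity) hcheb 2
    _ = (∑ i, u i * v i) ^ 2 * (∑ i, u i) ^ 2 := by ring
    _ ≤ ((∑ i, u i ^ 2) * ∑ i, v i ^ 2) * (∑ i, u i) ^ 2 := by gcongr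
    _ = _ := by ring

lemma modifiedGreenwood_le_one (n : ℕ) (x : Fin n → ℝ) : modifiedGreenwood n x ≤ 1 :=
  div_le_one_of_le₀ (Finset.sum_sq_le_sq_sum_of_nonneg fun _ _ => abs_nonneg _) (sq_nonneg _)

lemma measurable_modifiedGreenwood (n : ℕ) : Measurable (modifiedGreenwood n) := by
  unfold modifiedGreenwood
  fun_prop

lemma setOf_sq_add_eq_finite (q A : ℝ) {B : ℝ} (hB : B ≠ 0) :
    {x : ℝ | |x| ^ 2 + A = q * (|x| + B) ^ 2}.Finite := by
  let p : Polynomial ℝ := .C (1 - q) * .X ^ 2 + .C (-2 * q * B) * .X + .C (A - q * B ^ 2)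
  have hp : p ≠ 0 := by
    intro h
    -- The coefficients of degree 2 and 1 vanish together only if `q = 1` and `B = 0`.
    have h2 : p.coeff 2 = 0 := by rw [h]; simp
    have h1 : p.coeff 1 = 0 := by rw [h]; simp
    rw [show p = .C (A - q * B ^ 2) + .C (-2 * q * B) * .X + .C (1 - q) * .X ^ 2 by ring] at h1 h2
    simp only [Polynomial.coeff_add, Polynomial.coeff_C, Polynomial.coeff_C_mul_X,
      Polynomial.coeff_C_mul_X_pow] at h1 h2
    norm_num at h1 h2
    rcases h1 with h1 | h1
    · linarith
    · exact hB h1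
  have hfin := Polynomial.finite_setOfPred_isRoot hp
  refine (hfin.union (hfin.image Neg.neg)).subset fun x hx => ?_
  have hroot : p.IsRoot |x| := by
    simp only [Set.mem_ofPred_eq] at hx
    simp only [Polynomial.IsRoot.def, p, Polynomial.eval_add, Polynomial.eval_mul,
      Polynomial.eval_C, Polynomial.eval_pow, Polynomial.eval_X]
    linear_combination hx
  rcases abs_choice x with h | h
  · exact Or.inl (h ▸ hroot)
  · exact Or.inr ⟨|x|, hroot, by rw [h, neg_neg]⟩

/-- For at least two independent observations without atoms, the modified Greenwood statistic has
no atoms: given nonzero remaining observations, `S_n = q` is a nontrivial polynomial equation in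
the modulus of the first one. -/
lemma pi_modifiedGreenwood_eq_null {n : ℕ} (hn : 2 ≤ n) (μ : Measure ℝ) [IsProbabilityMeasure μ]
    [NullSingletonClass μ] (q : ℝ) :
    (Measure.pi fun _ : Fin n => μ) {x | modifiedGreenwood n x = q} = 0 := by
  obtain ⟨m, rfl⟩ : ∃ m, n = m + 2 := ⟨n - 2, by omega⟩
  have hsub : {x | modifiedGreenwood (m + 2) x = q} ⊆
      MeasurableEquiv.piFinSuccAbove (fun _ => ℝ) 0 ⁻¹'
        {z : ℝ × (Fin (m + 1) → ℝ) |
          |z.1| ^ 2 + ∑ i, |z.2 i| ^ 2 = q * (|z.1| + ∑ i, |z.2 i|) ^ 2} := by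
    intro x hx
    simp only [Set.mem_ofPred_eq, modifiedGreenwood] at hx
    -- The cleared equation also holds at the origin, where `S_n` takes the junk value `0 / 0 = 0`.
    have key : ∑ i, |x i| ^ 2 = q * (∑ i, |x i|) ^ 2 := by
      by_cases h0 : ∑ i, |x i| = 0
      · have := (Finset.sum_eq_zero_iff_of_nonneg fun i _ => abs_nonneg (x i)).1 h0
        rw [h0, Finset.sum_eq_zero fun _ hi => by rw [this _ hi]; norm_num]
        norm_num
      · rw [← hx]; field_simp
    rw [Fin.sum_univ_succ, Fin.sum_univ_succ (f := fun i => |x i|)] at key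
    simpa [MeasurableEquiv.piFinSuccAbove, Fin.insertNthEquiv, Fin.removeNth, Fin.tail] using key
  refine measure_mono_null hsub ?_
  have hmeas : MeasurableSet {z : ℝ × (Fin (m + 1) → ℝ) |
      |z.1| ^ 2 + ∑ i, |z.2 i| ^ 2 = q * (|z.1| + ∑ i, |z.2 i|) ^ 2} :=
    measurableSet_eq_fun (by fun_prop) (by fun_prop)
  -- Fubini, slicing at fixed values of all observations but the first.
  rw [(measurePreserving_piFinSuccAbove (fun _ => μ) 0).measure_preimage
    hmeas.nullMeasurableSet, ← Measure.prod_swap,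
    Measure.map_apply measurable_swap hmeas,
    Measure.measure_prod_null (measurable_swap hmeas)]
  filter_upwards [Measure.ae_eval_ne (fun _ : Fin (m + 1) => μ) 0 0] with y hy
  refine (setOf_sq_add_eq_finite q (∑ i, |y i| ^ 2) (B := ∑ i, |y i|) ?_).measure_zero μ
  exact (Finset.sum_pos' (fun i _ => abs_nonneg _) ⟨0, Finset.mem_univ _, abs_pos.2 hy⟩).ne'

/-! ### Quantiles of atomless distributions -/

lemma continuous_cdf (μ : Measure ℝ) [IsProbabilityMeasure μ] [NullSingletonClass μ] :
    Continuous (cdf μ) := by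
  refine continuous_iff_continuousAt.2 fun x => ?_
  rw [(monotone_cdf μ).continuousAt_iff_leftLim_eq_rightLim, StieltjesFunction.rightLim_eq]
  have h := (cdf μ).measure_singleton x
  rw [measure_cdf, measure_singleton, eq_comm, ENNReal.ofReal_eq_zero] at h
  exact le_antisymm ((monotone_cdf μ).leftLim_le le_rfl) (by linarith)

lemma cdf_quantile (μ : Measure ℝ) [IsProbabilityMeasure μ] [NullSingletonClass μ] {p : ℝ}
    (hp : p ∈ Set.Ioo (0 : ℝ) 1) : cdf μ (quantile μ p) = p := by
  have hcont := continuous_cdf μ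
  obtain ⟨q₀, hq₀⟩ : p ∈ Set.range (cdf μ) :=
    mem_range_of_exists_le_of_exists_ge hcont
      (((tendsto_cdf_atBot μ).eventually (gt_mem_nhds hp.1)).exists.imp fun _ h => h.le)
      (((tendsto_cdf_atTop μ).eventually (lt_mem_nhds hp.2)).exists.imp fun _ h => h.le)
  have hbdd : BddBelow {q : ℝ | p ≤ cdf μ q} := by
    obtain ⟨b, hb⟩ := ((tendsto_cdf_atBot μ).eventually (gt_mem_nhds hp.1)).exists
    refine ⟨b, fun q hq => le_of_not_gt fun hlt => ?_⟩
    exact absurd (hq.trans (monotone_cdf μ hlt.le)) (not_le.2 hb)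
  have hmem : quantile μ p ∈ {q : ℝ | p ≤ cdf μ q} :=
    (isClosed_le continuous_const hcont).csInf_mem ⟨q₀, hq₀.ge⟩ hbdd
  refine le_antisymm ?_ hmem
  exact (monotone_cdf μ (csInf_le hbdd hq₀.ge)).trans hq₀.le

lemma measureReal_Ici_quantile (μ : Measure ℝ) [IsProbabilityMeasure μ] [NullSingletonClass μ]
    {p : ℝ} (hp : p ∈ Set.Ioo (0 : ℝ) 1) : μ.real (Set.Ici (quantile μ p)) = 1 - p := by
  rw [measureReal_congr Ioi_ae_eq_Ici.symm, ← Set.compl_Iic,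
    probReal_compl_eq_one_sub measurableSet_Iic, ← cdf_eq_real, cdf_quantile μ hp]

/-! ### Star-shaped transport between symmetric distributions -/

section transport
variable {F G f g : ℝ → ℝ}

/-- Single crossing on the positive half-line of two distribution functions, the second one
rescaled by `c`. With `D s = F s - G (c * s)`, which vanishes at `0` and at infinity, the set where
`D' ≥ 0` is an interval. So `D` decreases, then increases, then decreases to `0`, and once positive
it stays nonnegative. -/
lemma scaled_cdf_crossing {c : ℝ} (hc : 0 < c) (hF : ∀ x, HasDerivAt F (f x) x)
    (hG : ∀ x, HasDerivAt G (g x) x) (hF1 : Tendsto F atTop (𝓝 1)) (hG1 : Tendsto G atTop (𝓝 1))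
    (h0 : F 0 = G 0)
    (hconv : {s | 0 ≤ s ∧ c * g (c * s) ≤ f s}.OrdConnected)
    {x y : ℝ} (hx : 0 < x) (hxy : x ≤ y) (h : G (c * x) < F x) : G (c * y) ≤ F y := by
  by_contra! hy
  have hD : ∀ s, HasDerivAt (fun s => F s - G (c * s)) (f s - c * g (c * s)) s := fun s => by
    have := (hG (c * s)).comp s ((hasDerivAt_id s).const_mul c)
    convert! (hF s).sub this using 1
    simp [mul_comm]
  have hxy' : x < y := hxy.lt_of_ne (by rintro rfl; exact absurd h hy.not_gt)
  have hDc : Continuous fun s => F s - G (c * s) :=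
    continuous_iff_continuousAt.2 fun s => (hD s).continuousAt
  -- If `D x > 0 > D y`, the mean value theorem gives `a < x` with `D' a > 0` and `b > x` with
  -- `D' b < 0`.
  obtain ⟨a, ha, ha'⟩ := exists_hasDerivAt_eq_slope _ _ hx hDc.continuousOn fun s _ => hD s
  obtain ⟨b, hb, hb'⟩ := exists_hasDerivAt_eq_slope _ _ hxy' hDc.continuousOn fun s _ => hD s
  have hapos : c * g (c * a) < f a := by
    have : 0 < f a - c * g (c * a) := by
      rw [ha']
      simp only [mul_zero, h0, sub_self, sub_zero]
      exact div_pos (by linarith) hx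
    linarith
  have hbneg : f b < c * g (c * b) := by
    have : f b - c * g (c * b) < 0 := by
      rw [hb']
      exact div_neg_of_neg_of_pos (by linarith) (by linarith)
    linarith
  -- The interval `{D' ≥ 0}` contains `a < b` but not `b`, so it contains no point beyond `b`:
  -- `D` decreases to `0` on `[y, ∞)`, against `D y < 0`.
  have hlate : ∀ s, b < s → f s - c * g (c * s) ≤ 0 := by
    intro s hs
    by_contra! hpos
    have := hconv.out ⟨ha.1.le, hapos.le⟩
      (⟨(hx.trans (hb.1.trans hs)).le, by linarith⟩ : s ∈ {s | 0 ≤ s ∧ c * g (c * s) ≤ f s})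
      ⟨(ha.2.trans hb.1).le, hs.le⟩
    exact absurd this.2 (not_le.2 hbneg)
  have hanti : AntitoneOn (fun s => F s - G (c * s)) (Set.Ici y) := by
    refine antitoneOn_of_deriv_nonpos (convex_Ici y) hDc.continuousOn
      (fun s _ => (hD s).differentiableAt.differentiableWithinAt) fun s hs => ?_
    rw [interior_Ici] at hs
    rw [(hD s).deriv]
    exact hlate s (hb.2.trans hs)
  have hlim : Tendsto (fun s => F s - G (c * s)) atTop (𝓝 0) := by
    simpa using hF1.sub (hG1.comp (tendsto_id.const_mul_atTop hc))
  have : 0 ≤ F y - G (c * y) :=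
    le_of_tendsto hlim (by
      filter_upwards [eventually_ge_atTop y] with s hs
      exact hanti (Set.mem_Ici.2 le_rfl) hs hs)
  linarith

lemma cdf_neg_of_even (hF : ∀ x, HasDerivAt F (f x) x) (hf : ∀ x, f (-x) = f x)
    (hF0 : Tendsto F atBot (𝓝 0)) (hF1 : Tendsto F atTop (𝓝 1)) (x : ℝ) : F (-x) = 1 - F x := by
  have hd : ∀ s, HasDerivAt (fun s => F s + F (-s)) 0 s := fun s => by
    have := (hF s).add ((hF (-s)).comp s (hasDerivAt_neg s))
    convert! this using 1
    simp [hf]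
  have hc : ∀ s, F s + F (-s) = F x + F (-x) := fun s =>
    is_const_of_deriv_eq_zero (fun s => (hd s).differentiableAt) (fun s => (hd s).deriv) s x
  have hlim : Tendsto (fun s => F s + F (-s)) atTop (𝓝 (1 + 0)) :=
    hF1.add (hF0.comp tendsto_neg_atTop_atBot)
  simp only [hc] at hlim
  have := tendsto_nhds_unique hlim tendsto_const_nhds
  linarith

end transport

/-- `μ` has the everywhere positive even density `f`, expressed by `f` being the derivative of the
distribution function of `μ` at every point. -/
structure HasEvenPosDensity (μ : Measure ℝ) (f : ℝ → ℝ) : Prop where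
  hasDerivAt_cdf : ∀ x, HasDerivAt (cdf μ) (f x) x
  even : ∀ x, f (-x) = f x
  pos : ∀ x, 0 < f x

namespace HasEvenPosDensity

variable {μ ν : Measure ℝ} {f g : ℝ → ℝ}

lemma continuous_cdf (h : HasEvenPosDensity μ f) : Continuous (cdf μ) :=
  continuous_iff_continuousAt.2 fun x => (h.hasDerivAt_cdf x).continuousAt

lemma strictMono_cdf (h : HasEvenPosDensity μ f) : StrictMono (cdf μ) :=
  strictMono_of_deriv_pos fun x => by rw [(h.hasDerivAt_cdf x).deriv]; exact h.pos x

lemma cdf_neg (h : HasEvenPosDensity μ f) (x : ℝ) : cdf μ (-x) = 1 - cdf μ x :=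
  cdf_neg_of_even h.hasDerivAt_cdf h.even (tendsto_cdf_atBot μ) (tendsto_cdf_atTop μ) x

lemma cdf_zero (h : HasEvenPosDensity μ f) : cdf μ 0 = 1 / 2 := by
  have := h.cdf_neg 0
  rw [neg_zero] at this
  linarith

lemma exists_cdf_eq (h : HasEvenPosDensity μ f) (hν : HasEvenPosDensity ν g) (x : ℝ) :
    ∃ y, cdf ν y = cdf μ x := by
  have h0 : 0 < cdf μ x := (cdf_nonneg μ (x - 1)).trans_lt (h.strictMono_cdf (by linarith))
  have h1 : cdf μ x < 1 := (h.strictMono_cdf (by linarith : x < x + 1)).trans_le (cdf_le_one μ _)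
  exact mem_range_of_exists_le_of_exists_ge hν.continuous_cdf
      (((tendsto_cdf_atBot ν).eventually (gt_mem_nhds h0)).exists.imp fun _ h => h.le)
      (((tendsto_cdf_atTop ν).eventually (lt_mem_nhds h1)).exists.imp fun _ h => h.le)

/-- If, for every scale `c > 0`, the density of `μ` dominates the density `s ↦ c * g (c * s)` of
the rescaled `ν` exactly on an interval of `[0, ∞)`, then `μ` precedes `ν` in the star order: the
quantile transform `ψ = G⁻¹ ∘ F` carries `μ` to `ν`, and `|ψ x| / |x|` is a nondecreasing function
of `|x|`. -/
theorem exists_starShaped_map [IsProbabilityMeasure μ] [IsProbabilityMeasure ν]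
    (hμ : HasEvenPosDensity μ f) (hν : HasEvenPosDensity ν g)
    (hconv : ∀ c, 0 < c → {s | 0 ≤ s ∧ c * g (c * s) ≤ f s}.OrdConnected) :
    ∃ ψ : ℝ → ℝ, Measurable ψ ∧ μ.map ψ = ν ∧ (∀ x, ψ x = 0 → x = 0) ∧
      ∀ x y, |x| ≤ |y| → |ψ x| * |y| ≤ |ψ y| * |x| := by
  choose ψ hψ using hμ.exists_cdf_eq hν
  have hmono : StrictMono ψ := fun x y hxy => by
    rw [← hν.strictMono_cdf.lt_iff_lt, hψ, hψ]
    exact hμ.strictMono_cdf hxy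
  have hmeas : Measurable ψ := hmono.monotone.measurable
  have hneg : ∀ x, ψ (-x) = -ψ x := fun x => hν.strictMono_cdf.injective (by
    rw [hψ, hμ.cdf_neg, hν.cdf_neg, hψ])
  have hzero : ψ 0 = 0 := hν.strictMono_cdf.injective (by rw [hψ, hμ.cdf_zero, hν.cdf_zero])
  have habs : ∀ x, |ψ x| = ψ |x| := fun x => by
    rcases le_total 0 x with h | h
    · rw [abs_of_nonneg h, abs_of_nonneg (hzero ▸ hmono.monotone h)]
    · rw [abs_of_nonpos h, abs_of_nonpos (hzero ▸ hmono.monotone h), hneg]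
  -- `ψ s / s` is nondecreasing on the positive half-line: each line through the origin that lies
  -- below the graph at `s` stays weakly below it afterwards.
  have hstar : ∀ s t, 0 < s → s ≤ t → ψ s * t ≤ ψ t * s := by
    intro s t hs hst
    have ht : 0 < t := hs.trans_le hst
    have hψs : 0 < ψ s := hzero ▸ hmono hs
    suffices ψ s / s ≤ ψ t / t by
      rwa [div_le_div_iff₀ hs ht] at this
    refine le_of_forall_lt_imp_le_of_dense fun c hc => ?_
    rcases le_or_gt c 0 with hc0 | hc0
    · exact hc0.trans (div_pos (hψs.trans_le (hmono.monotone hst)) ht).le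
    have h1 : cdf ν (c * s) < cdf μ s := by
      rw [← hψ]
      exact hν.strictMono_cdf ((lt_div_iff₀ hs).1 hc)
    have h2 := scaled_cdf_crossing hc0 hμ.hasDerivAt_cdf hν.hasDerivAt_cdf (tendsto_cdf_atTop μ)
      (tendsto_cdf_atTop ν) (by rw [hμ.cdf_zero, hν.cdf_zero]) (hconv c hc0) hs hst h1
    rw [← hψ, hν.strictMono_cdf.le_iff_le] at h2
    exact (le_div_iff₀ ht).2 h2
  refine ⟨ψ, hmeas, ?_, fun x hx => hmono.injective (hx.trans hzero.symm), fun x y hxy => ?_⟩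
  · have := Measure.isProbabilityMeasure_map (μ := μ) hmeas.aemeasurable
    refine Measure.eq_of_cdf _ _ (StieltjesFunction.ext fun y => ?_)
    obtain ⟨z, hz⟩ := hν.exists_cdf_eq hμ y
    have hzy : ψ z = y := hν.strictMono_cdf.injective (by rw [hψ, hz])
    have hpre : ψ ⁻¹' Set.Iic y = Set.Iic z := by
      ext s
      rw [Set.mem_preimage, ← hzy]
      exact hmono.le_iff_le
    rw [cdf_eq_real, map_measureReal_apply hmeas measurableSet_Iic, hpre, ← cdf_eq_real, hz]
  · rw [habs, habs]
    rcases (abs_nonneg x).eq_or_lt with h | h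
    · rw [← h, hzero]; simp
    · exact hstar _ _ h hxy

end HasEvenPosDensity

lemma hasDerivAt_cdf_of_density {μ : Measure ℝ} [IsProbabilityMeasure μ] {f : ℝ → ℝ}
    (hf : Continuous f) (hf0 : ∀ x, 0 ≤ f x)
    (hμ : μ = volume.withDensity fun t => ENNReal.ofReal (f t)) (x : ℝ) :
    HasDerivAt (cdf μ) (f x) x := by
  have hlin : ∫⁻ t, ENNReal.ofReal (f t) = 1 := by
    have := measure_univ (μ := μ)
    rwa [hμ, withDensity_apply _ MeasurableSet.univ, setLIntegral_univ] at this
  have hint : Integrable f :=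
    ⟨hf.aestronglyMeasurable, by
      rw [hasFiniteIntegral_iff_ofReal (Eventually.of_forall hf0), hlin]; exact ENNReal.one_lt_top⟩
  have hcdf : ∀ y, cdf μ y = ∫ t in Set.Iic y, f t := fun y => by
    rw [cdf_eq_real, measureReal_def, hμ, withDensity_apply _ measurableSet_Iic,
      integral_eq_lintegral_of_nonneg_ae (Eventually.of_forall hf0)
        hf.aestronglyMeasurable.restrict]
  have hcdf' : ∀ y, cdf μ y = (∫ t in (0 : ℝ)..y, f t) + cdf μ 0 := fun y => by
    rw [hcdf, hcdf, ← intervalIntegral.integral_Iic_sub_Iic hint.integrableOn hint.integrableOn]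
    ring
  rw [funext hcdf']
  exact (intervalIntegral.integral_hasDerivAt_right (hf.intervalIntegrable _ _)
    hf.stronglyMeasurable.stronglyMeasurableAtFilter hf.continuousAt).add_const _

/-! ### Normalisation and regularity of Student's density -/

lemma lintegral_rpow_mul_exp_neg_mul_Ioi {a r : ℝ} (ha : 0 < a) (hr : 0 < r) :
    ∫⁻ y in Set.Ioi 0, ENNReal.ofReal (y ^ (a - 1) * Real.exp (-(r * y))) =
      ENNReal.ofReal (r ^ (-a) * Real.Gamma a) := by
  have h := Real.integral_rpow_mul_exp_neg_mul_Ioi ha hr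
  have hpos : 0 < (1 / r) ^ a * Real.Gamma a :=
    mul_pos (Real.rpow_pos_of_pos (by positivity) _) (Real.Gamma_pos_of_pos ha)
  rw [← ofReal_integral_eq_lintegral_ofReal (.of_integral_ne_zero (h ▸ hpos.ne')), h, one_div,
    Real.inv_rpow hr.le, Real.rpow_neg hr.le]
  filter_upwards [ae_restrict_mem measurableSet_Ioi] with y hy
  exact mul_nonneg (Real.rpow_nonneg (le_of_lt hy) _) (Real.exp_pos _).le

lemma lintegral_exp_neg_mul_sq {b : ℝ} (hb : 0 < b) :
    ∫⁻ t : ℝ, ENNReal.ofReal (Real.exp (-b * t ^ 2)) = ENNReal.ofReal √(Real.pi / b) := by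
  rw [← integral_gaussian, ofReal_integral_eq_lintegral_ofReal (integrable_exp_neg_mul_sq hb)
    (Filter.Eventually.of_forall fun _ => (Real.exp_pos _).le)]

/-- The normalising integral of Student's density, from the representation of
`(1 + t² / k) ^ (-a) * Γ(a)` as a Gamma mixture of Gaussian functions of `t`. -/
lemma lintegral_one_add_sq_div_rpow_neg {a k : ℝ} (ha : 1 / 2 < a) (hk : 0 < k) :
    ∫⁻ t : ℝ, ENNReal.ofReal ((1 + t ^ 2 / k) ^ (-a) * Real.Gamma a) =
      ENNReal.ofReal (√(k * Real.pi) * Real.Gamma (a - 1 / 2)) := by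
  have hpos : ∀ t : ℝ, 0 < 1 + t ^ 2 / k := fun t => by positivity
  calc ∫⁻ t : ℝ, ENNReal.ofReal ((1 + t ^ 2 / k) ^ (-a) * Real.Gamma a)
      = ∫⁻ t : ℝ, ∫⁻ y in Set.Ioi 0,
          ENNReal.ofReal (y ^ (a - 1) * Real.exp (-((1 + t ^ 2 / k) * y))) := by
        simp_rw [lintegral_rpow_mul_exp_neg_mul_Ioi (by linarith : 0 < a) (hpos _)]
    _ = ∫⁻ y in Set.Ioi 0, ∫⁻ t : ℝ,
          ENNReal.ofReal (y ^ (a - 1) * Real.exp (-((1 + t ^ 2 / k) * y))) :=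
        lintegral_lintegral_swap (by fun_prop)
    _ = ∫⁻ y in Set.Ioi 0, ENNReal.ofReal √(k * Real.pi) *
          ENNReal.ofReal (y ^ (a - 1 / 2 - 1) * Real.exp (-(1 * y))) := by
        refine setLIntegral_congr_fun measurableSet_Ioi fun y (hy : 0 < y) => ?_
        have hsplit : ∀ t : ℝ, ENNReal.ofReal (y ^ (a - 1) * Real.exp (-((1 + t ^ 2 / k) * y))) =
            ENNReal.ofReal (y ^ (a - 1) * Real.exp (-y)) *
              ENNReal.ofReal (Real.exp (-(y / k) * t ^ 2)) := fun t => by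
          rw [← ENNReal.ofReal_mul (by positivity), mul_assoc, ← Real.exp_add]
          congr 3
          field_simp
          ring
        simp_rw [hsplit]
        rw [lintegral_const_mul _ (by fun_prop), lintegral_exp_neg_mul_sq (by positivity),
          ← ENNReal.ofReal_mul (by positivity), ← ENNReal.ofReal_mul (by positivity)]
        have hs : √(Real.pi / (y / k)) = √(k * Real.pi) * y ^ (-(1 / 2) : ℝ) := by
          rw [Real.rpow_neg hy.le, ← Real.sqrt_eq_rpow, ← Real.sqrt_inv,
            ← Real.sqrt_mul (by positivity)]
          congr 1
          field_simp
        rw [hs, show a - 1 / 2 - 1 = (a - 1) + -(1 / 2) by ring, Real.rpow_add hy, one_mul]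
        congr 1
        ring
    _ = ENNReal.ofReal (√(k * Real.pi) * Real.Gamma (a - 1 / 2)) := by
        rw [lintegral_const_mul _ (by fun_prop),
          lintegral_rpow_mul_exp_neg_mul_Ioi (by linarith) one_pos, Real.one_rpow, one_mul,
          ← ENNReal.ofReal_mul (by positivity)]

lemma lintegral_studentTDensity (ν : ℕ+) :
    ∫⁻ t, ENNReal.ofReal (studentTDensity ν t) = 1 := by
  have hk : (0 : ℝ) < ν := by exact_mod_cast ν.pos
  have hΓ : 0 < Real.Gamma ((ν : ℝ) / 2) := Real.Gamma_pos_of_pos (by positivity)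
  have hs : 0 < √((ν : ℝ) * Real.pi) := Real.sqrt_pos.2 (by positivity)
  have h : ∀ t, ENNReal.ofReal (studentTDensity ν t) =
      ENNReal.ofReal (1 / (√((ν : ℝ) * Real.pi) * Real.Gamma ((ν : ℝ) / 2))) *
        ENNReal.ofReal ((1 + t ^ 2 / (ν : ℝ)) ^ (-(((ν : ℝ) + 1) / 2)) *
          Real.Gamma (((ν : ℝ) + 1) / 2)) := fun t => by
    rw [← ENNReal.ofReal_mul (by positivity), studentTDensity]
    congr 1
    field_simp
  simp_rw [h]
  rw [lintegral_const_mul _ (by fun_prop), lintegral_one_add_sq_div_rpow_neg (by linarith) hk,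
    ← ENNReal.ofReal_mul (by positivity), show ((ν : ℝ) + 1) / 2 - 1 / 2 = (ν : ℝ) / 2 by ring,
    one_div_mul_cancel (by positivity), ENNReal.ofReal_one]

instance isProbabilityMeasure_studentT (ν : WithTop ℕ+) : IsProbabilityMeasure (studentT ν) := by
  induction ν using WithTop.recTopCoe with
  | top => exact inferInstanceAs (IsProbabilityMeasure (gaussianReal 0 1))
  | coe m =>
    refine ⟨?_⟩
    change (volume.withDensity fun t => ENNReal.ofReal (studentTDensity m t)) Set.univ = 1
    rw [withDensity_apply _ MeasurableSet.univ, setLIntegral_univ, lintegral_studentTDensity]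

lemma studentTDensity_pos (ν : ℕ+) (t : ℝ) : 0 < studentTDensity ν t := by
  have hk : (0 : ℝ) < ν := by exact_mod_cast ν.pos
  have h1 : 0 < Real.Gamma (((ν : ℝ) + 1) / 2) := Real.Gamma_pos_of_pos (by positivity)
  have h2 : 0 < Real.Gamma ((ν : ℝ) / 2) := Real.Gamma_pos_of_pos (by positivity)
  unfold studentTDensity
  positivity

lemma studentTDensity_neg (ν : ℕ+) (t : ℝ) : studentTDensity ν (-t) = studentTDensity ν t := by
  simp [studentTDensity]

lemma continuous_studentTDensity (ν : ℕ+) : Continuous (studentTDensity ν) := by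
  have hk : (0 : ℝ) < ν := by exact_mod_cast ν.pos
  refine continuous_const.mul (Continuous.rpow_const (by fun_prop) fun t => Or.inl ?_)
  positivity

/-! ### Comparison of the densities for different degrees of freedom -/

/-- In the variable `s²`, the set where a concave function dominates an affine one is convex, so it
is an interval. This yields the interval condition of `exists_starShaped_map`. -/
lemma ordConnected_setOf_affine_sq_le {h : ℝ → ℝ} (hh : ConcaveOn ℝ (Set.Ici 0) h) (α β : ℝ) :
    {s : ℝ | 0 ≤ s ∧ α + β * s ^ 2 ≤ h (s ^ 2)}.OrdConnected := by
  have hconv : Convex ℝ {u ∈ Set.Ici (0 : ℝ) | 0 ≤ h u - (α + β * u)} :=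
    (hh.sub ((convexOn_const α (convex_Ici 0)).add
      ((LinearMap.mulLeft ℝ β).convexOn (convex_Ici 0)))).convex_ge 0
  refine ⟨fun x hx y hy z hz => ⟨hx.1.trans hz.1, ?_⟩⟩
  have hz0 : 0 ≤ z := hx.1.trans hz.1
  have := hconv.ordConnected.out (x := x ^ 2) (y := y ^ 2) ⟨Set.mem_Ici.2 (sq_nonneg _), sub_nonneg.2 hx.2⟩
    ⟨Set.mem_Ici.2 (sq_nonneg _), sub_nonneg.2 hy.2⟩
    ⟨pow_le_pow_left₀ hx.1 hz.1 2, pow_le_pow_left₀ hz0 hz.2 2⟩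
  exact sub_nonneg.1 this.2

lemma concaveOn_one_add_mul_rpow {k θ : ℝ} (hk : 0 ≤ k) (hθ0 : 0 ≤ θ) (hθ1 : θ ≤ 1) :
    ConcaveOn ℝ (Set.Ici 0) fun u : ℝ => (1 + k * u) ^ θ := by
  refine ⟨convex_Ici 0, fun x hx y hy a b ha hb hab => ?_⟩
  have hx' : 0 ≤ 1 + k * x := add_nonneg zero_le_one (mul_nonneg hk hx)
  have hy' : 0 ≤ 1 + k * y := add_nonneg zero_le_one (mul_nonneg hk hy)
  convert (Real.concaveOn_rpow hθ0 hθ1).2 hx' hy' ha hb hab using 2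
  simp only [smul_eq_mul]
  linear_combination -hab

lemma concaveOn_log_one_add_mul {k : ℝ} (hk : 0 ≤ k) :
    ConcaveOn ℝ (Set.Ici 0) fun u : ℝ => Real.log (1 + k * u) := by
  refine ⟨convex_Ici 0, fun x hx y hy a b ha hb hab => ?_⟩
  have hx' : 0 < 1 + k * x := add_pos_of_pos_of_nonneg zero_lt_one (mul_nonneg hk hx)
  have hy' : 0 < 1 + k * y := add_pos_of_pos_of_nonneg zero_lt_one (mul_nonneg hk hy)
  convert strictConcaveOn_log_Ioi.concaveOn.2 hx' hy' ha hb hab using 2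
  simp only [smul_eq_mul]
  linear_combination -hab

/-- The normalising constant of Student's density with `ν` degrees of freedom. -/
noncomputable def studentTConst (ν : ℕ+) : ℝ :=
  1 / √((ν : ℝ) * Real.pi) * (Real.Gamma (((ν : ℝ) + 1) / 2) / Real.Gamma ((ν : ℝ) / 2))

lemma studentTConst_pos (ν : ℕ+) : 0 < studentTConst ν := by
  have h := studentTDensity_pos ν 0
  simpa [studentTDensity, studentTConst] using h

lemma mul_mul_inv_le_mul_inv_iff {c k K x y : ℝ} (hK : 0 < K) (hx : 0 < x) (hy : 0 < y) :
    c * (k * x⁻¹) ≤ K * y⁻¹ ↔ c * k / K * y ≤ x := by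
  rw [← mul_assoc, ← div_eq_mul_inv, ← div_eq_mul_inv, div_le_div_iff₀ hx hy,
    div_mul_eq_mul_div, div_le_iff₀ hK, mul_comm K]

/-- After raising to the power `2 / (p + 1)`, the inequality between the densities compares an
affine function of `s²` with `(1 + c² s² / m) ^ ((m + 1) / (p + 1))`, which is concave in `s²`
as `m ≤ p`. -/
lemma ordConnected_studentTDensity_le {m p : ℕ+} (hmp : m ≤ p) {c : ℝ} (hc : 0 < c) :
    {s | 0 ≤ s ∧ c * studentTDensity m (c * s) ≤ studentTDensity p s}.OrdConnected := by
  have hm : (0 : ℝ) < m := by exact_mod_cast m.pos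
  have hp : (0 : ℝ) < p := by exact_mod_cast p.pos
  have hmp' : (m : ℝ) ≤ p := by exact_mod_cast hmp
  have hKm := studentTConst_pos m
  have hKp := studentTConst_pos p
  set R : ℝ := c * studentTConst m / studentTConst p with hR
  have hRpos : 0 < R := by positivity
  set b : ℝ := ((p : ℝ) + 1) / 2 with hb
  set a : ℝ := ((m : ℝ) + 1) / 2 with ha
  have hbpos : 0 < b := by positivity
  have hapos : 0 < a := by positivity
  have hab : a ≤ b := by linarith
  convert ordConnected_setOf_affine_sq_le
    (concaveOn_one_add_mul_rpow (k := c ^ 2 / m) (θ := a / b) (by positivity) (by positivity)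
      ((div_le_one hbpos).2 hab)) (R ^ b⁻¹) (R ^ b⁻¹ / p) using 3 with s
  refine and_congr_right fun hs => ?_
  have hx : 0 < 1 + c ^ 2 / m * s ^ 2 := by positivity
  have hy : 0 < 1 + s ^ 2 / p := by positivity
  have e1 : studentTDensity m (c * s) = studentTConst m * ((1 + c ^ 2 / m * s ^ 2) ^ a)⁻¹ := by
    rw [← Real.rpow_neg hx.le, studentTDensity, studentTConst, mul_pow, mul_div_right_comm]
  have e2 : studentTDensity p s = studentTConst p * ((1 + s ^ 2 / p) ^ b)⁻¹ := by
    rw [← Real.rpow_neg hy.le, studentTDensity, studentTConst]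
  have e3 : R ^ b⁻¹ + R ^ b⁻¹ / p * s ^ 2 = (R * (1 + s ^ 2 / p) ^ b) ^ b⁻¹ := by
    rw [Real.mul_rpow hRpos.le (by positivity), Real.rpow_rpow_inv hy.le hbpos.ne']
    ring
  have e4 : (1 + c ^ 2 / m * s ^ 2) ^ (a / b) = ((1 + c ^ 2 / m * s ^ 2) ^ a) ^ b⁻¹ := by
    rw [← Real.rpow_mul hx.le, div_eq_mul_inv a b]
  rw [e1, e2, e3, e4, Real.rpow_le_rpow_iff (by positivity) (by positivity) (by positivity)]
  have hxa : 0 < (1 + c ^ 2 / m * s ^ 2) ^ a := by positivity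
  have hyb : 0 < (1 + s ^ 2 / p) ^ b := by positivity
  exact mul_mul_inv_le_mul_inv_iff hKp hxa hyb

/-- After taking logarithms, the inequality between the densities compares an affine function of
`s²` with `log (1 + c² s² / m)`, which is concave in `s²`. -/
lemma ordConnected_studentTDensity_le_gaussianPDFReal (m : ℕ+) {c : ℝ} (hc : 0 < c) :
    {s | 0 ≤ s ∧ c * studentTDensity m (c * s) ≤ gaussianPDFReal 0 1 s}.OrdConnected := by
  have hm : (0 : ℝ) < m := by exact_mod_cast m.pos
  have hKm := studentTConst_pos m
  set a : ℝ := ((m : ℝ) + 1) / 2 with ha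
  have hapos : 0 < a := by positivity
  set K : ℝ := (√(2 * Real.pi))⁻¹ with hK
  have hKpos : 0 < K := inv_pos.2 (Real.sqrt_pos.2 (by positivity))
  set R : ℝ := c * studentTConst m / K with hR
  have hRpos : 0 < R := by positivity
  convert ordConnected_setOf_affine_sq_le
    (concaveOn_log_one_add_mul (k := c ^ 2 / m) (by positivity))
      (Real.log R / a) (1 / (2 * a)) using 3 with s
  refine and_congr_right fun hs => ?_
  have hx : 0 < 1 + c ^ 2 / m * s ^ 2 := by positivity
  have hxa : 0 < (1 + c ^ 2 / m * s ^ 2) ^ a := by positivity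
  have e1 : studentTDensity m (c * s) = studentTConst m * ((1 + c ^ 2 / m * s ^ 2) ^ a)⁻¹ := by
    rw [← Real.rpow_neg hx.le, studentTDensity, studentTConst, mul_pow, mul_div_right_comm]
  have e2 : gaussianPDFReal 0 1 s = K * (Real.exp (s ^ 2 / 2))⁻¹ := by
    rw [← Real.exp_neg, gaussianPDFReal]
    simp [hK, neg_div]
  have e3 : Real.log R / a + 1 / (2 * a) * s ^ 2 ≤ Real.log (1 + c ^ 2 / m * s ^ 2) ↔
      R * Real.exp (s ^ 2 / 2) ≤ (1 + c ^ 2 / m * s ^ 2) ^ a := by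
    rw [← Real.log_le_log_iff (by positivity) hxa, Real.log_rpow hx,
      Real.log_mul hRpos.ne' (Real.exp_pos _).ne', Real.log_exp, ← div_le_iff₀' hapos]
    rw [show (Real.log R + s ^ 2 / 2) / a = Real.log R / a + 1 / (2 * a) * s ^ 2 by field_simp]
  rw [e3, e1, e2]
  exact mul_mul_inv_le_mul_inv_iff hKpos hxa (Real.exp_pos _)

/-! ### Monotonicity and size of the test -/

lemma hasEvenPosDensity_studentT_coe (m : ℕ+) :
    HasEvenPosDensity (studentT m) (studentTDensity m) where
  hasDerivAt_cdf := hasDerivAt_cdf_of_density (continuous_studentTDensity m)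
    (fun t => (studentTDensity_pos m t).le) rfl
  even := studentTDensity_neg m
  pos := studentTDensity_pos m

lemma hasEvenPosDensity_studentT_top : HasEvenPosDensity (studentT ⊤) (gaussianPDFReal 0 1) where
  hasDerivAt_cdf := by
    refine hasDerivAt_cdf_of_density ?_ (gaussianPDFReal_nonneg 0 1)
      (gaussianReal_of_var_ne_zero 0 one_ne_zero)
    rw [gaussianPDFReal_def]
    fun_prop
  even x := by simp [gaussianPDFReal]
  pos x := gaussianPDFReal_pos 0 1 x one_ne_zero

/-- Student's distributions decrease in the star order as the degrees of freedom increase, down to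
the normal distribution. -/
theorem exists_starShaped_map_studentT {ν₁ ν₂ : WithTop ℕ+} (h : ν₁ ≤ ν₂) :
    ∃ ψ : ℝ → ℝ, Measurable ψ ∧ (studentT ν₂).map ψ = studentT ν₁ ∧ (∀ x, ψ x = 0 → x = 0) ∧
      ∀ x y, |x| ≤ |y| → |ψ x| * |y| ≤ |ψ y| * |x| := by
  induction ν₁ using WithTop.recTopCoe with
  | top =>
    obtain rfl := top_le_iff.1 h
    exact ⟨id, measurable_id, Measure.map_id, fun _ => id, fun x y _ => (mul_comm _ _).le⟩
  | coe m =>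
    induction ν₂ using WithTop.recTopCoe with
    | top =>
      exact hasEvenPosDensity_studentT_top.exists_starShaped_map
        (hasEvenPosDensity_studentT_coe m) fun c hc =>
          ordConnected_studentTDensity_le_gaussianPDFReal m hc
    | coe p =>
      exact (hasEvenPosDensity_studentT_coe p).exists_starShaped_map
        (hasEvenPosDensity_studentT_coe m) fun c hc =>
          ordConnected_studentTDensity_le (WithTop.coe_le_coe.1 h) hc

/-- The upper bound `1` in the rejection region is vacuous. -/
lemma mgRejectionRegion_eq (n : ℕ) (c : ℝ) :
    mgRejectionRegion n c = modifiedGreenwood n ⁻¹' Set.Ici (mgCriticalValue n c) :=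
  Set.ext fun x => and_iff_left (modifiedGreenwood_le_one n x)

instance isProbabilityMeasure_studentTSample (n : ℕ) (ν : WithTop ℕ+) :
    IsProbabilityMeasure (studentTSample n ν) := by
  unfold studentTSample
  infer_instance

theorem powerFunction_studentTSample_top {n : ℕ} (hn : 2 ≤ n) {c : ℝ}
    (hc : c ∈ Set.Ioo (0 : ℝ) 1) :
    powerFunction (studentTSample n) (mgRejectionRegion n c) ⊤ = c := by
  have hS := measurable_modifiedGreenwood n
  have : IsProbabilityMeasure ((studentTSample n ⊤).map (modifiedGreenwood n)) :=
    Measure.isProbabilityMeasure_map hS.aemeasurable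
  have : NullSingletonClass (studentT ⊤) := nullSingletonClass_gaussianReal one_ne_zero
  have : NullSingletonClass ((studentTSample n ⊤).map (modifiedGreenwood n)) := ⟨fun q => by
    rw [Measure.map_apply hS (measurableSet_singleton q)]
    exact pi_modifiedGreenwood_eq_null hn _ q⟩
  rw [powerFunction, mgRejectionRegion_eq, ← map_measureReal_apply hS measurableSet_Ici,
    mgCriticalValue, measureReal_Ici_quantile _ ⟨by linarith [hc.2], by linarith [hc.1]⟩,
    sub_sub_cancel]

theorem antitone_powerFunction_studentTSample (n : ℕ) (c : ℝ) :
    Antitone (powerFunction (studentTSample n) (mgRejectionRegion n c)) := by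
  intro ν₁ ν₂ h
  obtain ⟨ψ, hψ, hmap, hzero, hstar⟩ := exists_starShaped_map_studentT h
  have hψn : Measurable fun (x : Fin n → ℝ) i => ψ (x i) := by fun_prop
  have hpush : (studentTSample n ν₂).map (fun x i => ψ (x i)) = studentTSample n ν₁ := by
    have : ∀ _ : Fin n, SigmaFinite ((studentT ν₂).map ψ) := fun _ => hmap ▸ inferInstance
    rw [studentTSample, Measure.pi_map_pi (fun _ => hψ.aemeasurable), hmap, studentTSample]
  have hR : MeasurableSet (mgRejectionRegion n c) :=
    measurable_modifiedGreenwood n measurableSet_Icc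
  rw [powerFunction, powerFunction, ← hpush, map_measureReal_apply hψn hR, mgRejectionRegion_eq]
  refine measureReal_mono fun x hx => ?_
  refine (Set.mem_Ici.1 hx).trans (greenwood_le_of_comonotone (fun i => abs_nonneg _)
    (fun i => abs_nonneg _) (fun i hi => ?_) fun i j hij => hstar _ _ hij)
  exact abs_eq_zero.2 (hzero _ (abs_eq_zero.1 hi))

theorem proposition5 (n : ℕ) (hn : 2 ≤ n) (c : ℝ) (hc : c ∈ Set.Ioo (0 : ℝ) 1) :
    HasSize (studentTSample n) (mgRejectionRegion n c) {⊤} c ∧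
      IsUnbiasedTest (studentTSample n) (mgRejectionRegion n c) {⊤} {ν | ν < ⊤} ∧
      Antitone (powerFunction (studentTSample n) (mgRejectionRegion n c)) := by
  have hanti := antitone_powerFunction_studentTSample n c
  refine ⟨?_, ?_, hanti⟩
  · rw [HasSize, Set.image_singleton, powerFunction_studentTSample_top hn hc]
    exact isLUB_singleton
  · rintro _ rfl θ _
    exact hanti le_top
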